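/- Let $G=(V,E)$ be a finite directed acyclic graph, possibly with parallel edges, with two sources $s_1,s_2$ and two terminals $t_1,t_2$, where $s_i\neq t_j$ for all $i,j$. For nonempty $A,B\subseteq\{1,2\}$ let $k_{A-B}$ be the minimum cut between $\{s_i:i\in A\}$ and $\{t_j:j\in B\}$, that is, the minimum, over vertex sets $U$ containing every $s_i$ ($i\in A$) and no $t_j$ ($j\in B$), of the number of edges from $U$ to $V\setminus U$; write $k_{12-1}$ for $k_{\{1,2\}-\{1\}}$, and so on. A linear network code over a finite field $F$ with integer rates $(R_1,R_2)$ works as follows. Source $s_i$ holds an arbitrary vector $X_i\in F^{R_i}$. Every edge carries one symbol of $F$, which is a fixed $F$-linear combination of the symbols on the edges entering its tail and, if its tail is $s_i$, of the entries of $X_i$. A terminal recovers $X_i$ if $X_i$ is a function of the symbols on the edges entering that terminal. The code serves the two unicast sessions if $t_i$ recovers $X_i$ for $i=1,2$. It multicasts both sources to both terminals if each of $t_1,t_2$ recovers both $X_1$ and $X_2$. Let $$\mathcal B=\{(R_1,R_2)\in\mathbb R_{\ge 0}^2:\ R_1\le\min(k_{1-2},k_{1-1}),\ R_2\le\min(k_{2-1},k_{2-2}),\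 R_1+R_2\le\min(k_{12-1},k_{12-2})\}.$$ Then there is a finite field $F$ such that the following hold. 1. For every pair of nonnegative integers $(R_1,R_2)\in\mathcal B$ there is a linear network code over $F$ with rates $(R_1,R_2)$ that serves the two unicast sessions, and it does so by multicasting both sources to both terminals. 2. Every real pair $(R_1,R_2)\in\mathcal B$ is achieved by time sharing between such codes over $F$, that is, it is a convex combination of integer rate pairs of linear network codes over $F$ that multicast both sources to both terminals. -/

import Mathlib

/-- A directed network with vertices `V` and edges `E` (parallel edges are allowed, every edge has
unit capacity), without directed cycles, with two sources `source 0`, `source 1` and two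
terminals `terminal 0`, `terminal 1`; session `i` goes from `source i` to `terminal i`.
No source is a terminal. Edges into sources and out of terminals are not excluded. -/
structure TwoUnicastNetwork (V E : Type*) where
  tail : E → V
  head : E → V
  source : Fin 2 → V
  terminal : Fin 2 → V
  acyclic : ∀ v : V, ¬ Relation.TransGen (fun u w => ∃ e : E, tail e = u ∧ head e = w) v v
  source_ne_terminal : ∀ i j : Fin 2, source i ≠ terminal j

namespace TwoUnicastNetwork

variable {V E : Type*}

/-- The minimum cut `k_{A-B}` between the sources indexed by `A` and the terminals indexed by `B`:
the least number of edges leaving a vertex set `U` that contains all those sources and none of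
those terminals. -/
noncomputable def mincut (N : TwoUnicastNetwork V E) (A B : Set (Fin 2)) : ℕ :=
  sInf {n : ℕ | ∃ U : Set V, (∀ i ∈ A, N.source i ∈ U) ∧ (∀ j ∈ B, N.terminal j ∉ U) ∧
    n = Set.ncard {e : E | N.tail e ∈ U ∧ N.head e ∉ U}}

/-- A (scalar) linear network code over `F` in which source `i` emits `R i` symbols of `F` and every
edge carries one symbol of `F`. `a i j e` and `f e' e` are the local coding coefficients, and
`signal x e` is the symbol on edge `e` when the source symbols are `x`. By acyclicity the signals
are determined by the local coding coefficients. If no edge enters a source and the sources are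
distinct, an edge out of source `i` carries a combination of the symbols of source `i` only, and
every other edge carries a combination of the signals on the edges entering its tail. -/
structure LinearCode [Fintype E] (N : TwoUnicastNetwork V E) (F : Type*) [Field F]
    (R : Fin 2 → ℕ) where
  a : (i : Fin 2) → Fin (R i) → E → F
  f : E → E → F
  signal : ((i : Fin 2) → Fin (R i) → F) → E → F
  signal_eq : ∀ (x : (i : Fin 2) → Fin (R i) → F) (e : E), signal x e =
    (open scoped Classical in
      ∑ e' ∈ Finset.univ.filter (fun e' : E => N.head e' = N.tail e), f e' e * signal x e'
        + ∑ i ∈ Finset.univ.filter (fun i : Fin 2 => N.source i = N.tail e),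
            ∑ j : Fin (R i), a i j e * x i j)

namespace LinearCode

variable [Fintype E] {N : TwoUnicastNetwork V E} {F : Type*} [Field F] {R : Fin 2 → ℕ}

/-- Terminal `t` can recover all symbols of source `i` from the signals on its incoming edges. -/
def Recovers (c : N.LinearCode F R) (t i : Fin 2) : Prop :=
  ∃ decode : ({e : E // N.head e = N.terminal t} → F) → (Fin (R i) → F),
    ∀ x : (i : Fin 2) → Fin (R i) → F, decode (fun e => c.signal x e.1) = x i

/-- The code serves the two unicast sessions: each terminal recovers its own source. -/
def IsUnicast (c : N.LinearCode F R) : Prop := ∀ i : Fin 2, c.Recovers i i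

/-- The code multicasts both sources to both terminals. -/
def IsMulticast (c : N.LinearCode F R) : Prop := ∀ t i : Fin 2, c.Recovers t i

end LinearCode

/-- The base region, as a set of pairs of nonnegative reals. -/
def baseRegion (N : TwoUnicastNetwork V E) : Set (ℝ × ℝ) :=
  {R | 0 ≤ R.1 ∧ 0 ≤ R.2 ∧
    R.1 ≤ min (N.mincut {0} {1} : ℝ) (N.mincut {0} {0} : ℝ) ∧
    R.2 ≤ min (N.mincut {1} {0} : ℝ) (N.mincut {1} {1} : ℝ) ∧
    R.1 + R.2 ≤ min (N.mincut {0, 1} {0} : ℝ) (N.mincut {0, 1} {1} : ℝ)}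

/-- The integer rate pairs at which some linear code over `F` serves the two unicast sessions by
multicasting both sources to both terminals. -/
def multicastRates [Fintype E] (N : TwoUnicastNetwork V E) (F : Type*) [Field F] :
    Set (Fin 2 → ℕ) :=
  {R | ∃ c : N.LinearCode F R, c.IsUnicast ∧ c.IsMulticast}

/-- The rate pairs obtained from those integer rate pairs by time sharing. -/
def timeSharedRates [Fintype E] (N : TwoUnicastNetwork V E) (F : Type*) [Field F] :
    Set (ℝ × ℝ) :=
  convexHull ℝ ((fun R : Fin 2 → ℕ => ((R 0 : ℝ), (R 1 : ℝ))) '' N.multicastRates F)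

end TwoUnicastNetwork

/-! Give every edge a global coding vector indexed by the source symbols. In topological order, pick
each vector in the span of its inputs, outside every span of earlier symbols not containing all
these inputs; a field with more elements than there are sets of symbols leaves room
(`exists_isGenericAt`). Generic vectors satisfy a max-flow min-cut bound: a set of symbols spans at
least as many dimensions as some separator has elements (`exists_blocking_card_le_finrank`). The cut
conditions make every separator of a terminal at least as large as the total rate
(`sum_rates_le_card_of_blocked`), so the terminal receives vectors of full rank and decodes
everything.

Integer rates in the region sum to at most the number of edges, so one field suffices. For time
sharing, a polygon with these integral bounds is the hull of its integer points. -/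

/-- If a subspace `S` is contained in none of fewer than `|F|` subspaces, some vector of `S` avoids
all of them. -/
theorem Submodule.exists_mem_forall_notMem_of_card_lt {F W α : Type*} [Field F] [Finite F]
    [AddCommGroup W] [Module F W] (S : Submodule F W) (p : α → Submodule F W) (s : Finset α)
    (hs : s.card < Nat.card F) (hp : ∀ i ∈ s, ¬ S ≤ p i) :
    ∃ v ∈ S, ∀ i ∈ s, v ∉ p i := by
  classical
  have := Fintype.ofFinite F
  induction s using Finset.induction_on with
  | empty => exact ⟨0, S.zero_mem, by simp⟩
  | insert k s hk ih =>
    rw [Finset.card_insert_of_notMem hk] at hs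
    obtain ⟨v, hvS, hv⟩ := ih (by omega) fun i hi => hp i (Finset.mem_insert_of_mem hi)
    by_cases hvk : v ∈ p k
    swap
    · refine ⟨v, hvS, fun i hi => ?_⟩
      rcases Finset.mem_insert.1 hi with rfl | hi
      exacts [hvk, hv i hi]
    obtain ⟨w, hwS, hwk⟩ := SetLike.not_le_iff_exists.1 (hp k (Finset.mem_insert_self k s))
    -- Two parameters on the line `w + a • v` in the same `p i` would force `v ∈ p i`. The line
    -- misses `p k` altogether, as `v ∈ p k` and `w ∉ p k`.
    have hone : ∀ i ∈ s, (Finset.univ.filter fun a : F => w + a • v ∈ p i).card ≤ 1 := by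
      intro i hi
      refine Finset.card_le_one.2 fun a ha b hb => ?_
      by_contra hab
      have hmem := (p i).sub_mem (Finset.mem_filter.1 ha).2 (Finset.mem_filter.1 hb).2
      rw [add_sub_add_left_eq_sub, ← sub_smul] at hmem
      exact hv i hi (((p i).smul_mem_iff (sub_ne_zero.2 hab)).1 hmem)
    have hlt : (s.biUnion fun i => Finset.univ.filter fun a : F => w + a • v ∈ p i).card
        < (Finset.univ : Finset F).card := by
      rw [Finset.card_univ, ← Nat.card_eq_fintype_card]
      have := Finset.card_biUnion_le_card_mul s
        (fun i => Finset.univ.filter fun a : F => w + a • v ∈ p i) 1 hone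
      omega
    obtain ⟨a, -, ha⟩ := Finset.exists_mem_notMem_of_card_lt_card hlt
    refine ⟨w + a • v, S.add_mem hwS (S.smul_mem a hvS), fun i hi => ?_⟩
    rcases Finset.mem_insert.1 hi with rfl | hi
    · exact fun h => hwk (((p i).add_mem_iff_left ((p i).smul_mem a hvk)).1 h)
    · exact fun h => ha (Finset.mem_biUnion.2 ⟨i, hi, by simpa using h⟩)

/-! ### Generic coding vectors -/

/-- The coding vectors of all symbols: those of the coded symbols `ι` are given, the source symbols
`κ` have the standard basis vectors. -/
def codingVector {ι κ F : Type*} [Field F] [DecidableEq κ] (g : ι → κ → F) : ι ⊕ κ → κ → F :=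
  Sum.elim g fun q => Pi.single q 1

/-- `g e` is a combination of the inputs of the coded symbol `e`, and it lies in the span of
symbols preceding `e` only if all the inputs of `e` do. -/
def IsGenericAt {ι κ F : Type*} [Field F] [DecidableEq κ] (input : ι → Finset (ι ⊕ κ))
    (ord : ι → ℕ) (g : ι → κ → F) (e : ι) : Prop :=
  g e ∈ Submodule.span F (codingVector g '' (input e : Set (ι ⊕ κ))) ∧
    ∀ T : Finset (ι ⊕ κ), (∀ e', Sum.inl e' ∈ T → ord e' < ord e) →
      g e ∈ Submodule.span F (codingVector g '' (T : Set (ι ⊕ κ))) →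
      Submodule.span F (codingVector g '' (input e : Set (ι ⊕ κ))) ≤
        Submodule.span F (codingVector g '' (T : Set (ι ⊕ κ)))

theorem codingVector_update_image {ι κ F : Type*} [Field F] [DecidableEq κ] [DecidableEq ι]
    (g : ι → κ → F) (e : ι) (v : κ → F) (T : Set (ι ⊕ κ)) (hT : Sum.inl e ∉ T) :
    codingVector (Function.update g e v) '' T = codingVector g '' T := by
  refine Set.image_congr fun p hp => ?_
  rcases p with e' | q
  · have : e' ≠ e := by rintro rfl; exact hT hp
    simp [codingVector, this]
  · rfl

theorem exists_isGenericAt {ι κ : Type*} [Fintype ι] [Fintype κ] [DecidableEq κ]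
    (F : Type*) [Field F] [Finite F] (input : ι → Finset (ι ⊕ κ)) (ord : ι → ℕ)
    (hinj : Function.Injective ord) (hord : ∀ e e', Sum.inl e' ∈ input e → ord e' < ord e)
    (hF : 2 ^ (Fintype.card ι + Fintype.card κ) < Nat.card F) :
    ∃ g : ι → κ → F, ∀ e, IsGenericAt input ord g e := by
  classical
  have key : ∀ n, ∃ g : ι → κ → F, ∀ e, ord e < n → IsGenericAt input ord g e := by
    intro n
    induction n with
    | zero => exact ⟨0, by simp⟩
    | succ n ih =>
      obtain ⟨g, hg⟩ := ih
      by_cases hn : ∃ e, ord e = n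
      swap
      · refine ⟨g, fun e he => hg e ?_⟩
        have : ord e ≠ n := fun h => hn ⟨e, h⟩
        omega
      obtain ⟨e, rfl⟩ := hn
      obtain ⟨v, hvS, hv⟩ := Submodule.exists_mem_forall_notMem_of_card_lt
        (Submodule.span F (codingVector g '' (input e : Set (ι ⊕ κ))))
        (fun T : Finset (ι ⊕ κ) => Submodule.span F (codingVector g '' (T : Set (ι ⊕ κ))))
        (Finset.univ.filter fun T : Finset (ι ⊕ κ) =>
          ¬ Submodule.span F (codingVector g '' (input e : Set (ι ⊕ κ))) ≤
            Submodule.span F (codingVector g '' (T : Set (ι ⊕ κ))))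
        (lt_of_le_of_lt (Finset.card_le_univ _) (by
          rwa [Fintype.card_finset, Fintype.card_sum]))
        (fun T hT => (Finset.mem_filter.1 hT).2)
      refine ⟨Function.update g e v, fun d hd => ?_⟩
      have hinput : codingVector (Function.update g e v) '' (input d : Set (ι ⊕ κ))
          = codingVector g '' (input d : Set (ι ⊕ κ)) := by
        refine codingVector_update_image g e v _ fun h => ?_
        have := hord d e h
        omega
      have hT : ∀ T : Finset (ι ⊕ κ), (∀ e', Sum.inl e' ∈ T → ord e' < ord d) →
          codingVector (Function.update g e v) '' (T : Set (ι ⊕ κ))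
            = codingVector g '' (T : Set (ι ⊕ κ)) := by
        intro T hT
        refine codingVector_update_image g e v _ fun h => ?_
        have := hT e h
        omega
      by_cases hde : d = e
      · subst hde
        refine ⟨by rw [hinput]; simpa using hvS, fun T hTd hmem => ?_⟩
        rw [hT T hTd] at hmem ⊢
        rw [hinput]
        by_contra hnot
        exact hv T (by simpa using hnot) (by simpa using hmem)
      · have hlt : ord d < ord e := by
          have := hinj.ne hde
          omega
        obtain ⟨h1, h2⟩ := hg d hlt
        refine ⟨by rw [hinput]; simpa [hde] using h1, fun T hTd hmem => ?_⟩
        rw [hT T hTd] at hmem ⊢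
        rw [hinput]
        exact h2 T hTd (by simpa [hde] using hmem)
  obtain ⟨g, hg⟩ := key (Finset.univ.sup ord + 1)
  exact ⟨g, fun e => hg e (Nat.lt_succ_of_le (Finset.le_sup (Finset.mem_univ e)))⟩

/-! ### Separators and dimension -/

/-- The symbols that depend only on those in `C`. -/
inductive Blocked {ι κ : Type*} (input : ι → Finset (ι ⊕ κ)) (C : Finset (ι ⊕ κ)) : ι ⊕ κ → Prop
  | of_mem {p : ι ⊕ κ} (hp : p ∈ C) : Blocked input C p
  | of_input {e : ι} (he : ∀ p ∈ input e, Blocked input C p) : Blocked input C (Sum.inl e)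

theorem Blocked.mono {ι κ : Type*} {input : ι → Finset (ι ⊕ κ)} {C D : Finset (ι ⊕ κ)}
    (hCD : C ⊆ D) {p : ι ⊕ κ} (h : Blocked input C p) : Blocked input D p := by
  induction h with
  | of_mem hp => exact .of_mem (hCD hp)
  | of_input _ ih => exact .of_input ih

/-- Generic coding vectors of a set `T` of symbols span a space whose dimension is at least the
size of some set of symbols separating `T` from the sources. -/
theorem exists_blocking_card_le_finrank {ι κ F : Type*} [Fintype κ]
    [DecidableEq κ] [Field F] (input : ι → Finset (ι ⊕ κ)) (ord : ι → ℕ)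
    (hinj : Function.Injective ord) (hord : ∀ e e', Sum.inl e' ∈ input e → ord e' < ord e)
    (g : ι → κ → F) (hg : ∀ e, IsGenericAt input ord g e) (n : ℕ) :
    ∀ T : Finset (ι ⊕ κ), (∀ e, Sum.inl e ∈ T → ord e < n) →
      ∃ C : Finset (ι ⊕ κ), (∀ p ∈ T, Blocked input C p) ∧ C.card ≤
        Module.finrank F (Submodule.span F (codingVector g '' (T : Set (ι ⊕ κ)))) := by
  classical
  induction n with
  | zero =>
    intro T hT
    refine ⟨T, fun p hp => .of_mem hp, ?_⟩
    have hsource : ∀ p : T, ∃ q, p.1 = Sum.inr q := by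
      rintro ⟨e | q, hp⟩
      · exact absurd (hT e hp) (Nat.not_lt_zero _)
      · exact ⟨q, rfl⟩
    choose q hq using hsource
    have hind : LinearIndependent F fun p : T => codingVector g p.1 := by
      have hq_inj : Function.Injective q := fun a b hab =>
        Subtype.ext (by rw [hq a, hq b, hab])
      convert (Pi.basisFun F κ).linearIndependent.comp q hq_inj using 1
      funext p
      rw [hq p]
      simp [codingVector]
    have := finrank_span_eq_card hind
    rw [Set.image_eq_range]
    exact ((Fintype.card_coe T).symm.trans this.symm).le
  | succ n ih =>
    intro T hT
    by_cases hn : ∃ e, Sum.inl e ∈ T ∧ ord e = n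
    swap
    · refine ih T fun e he => ?_
      have h1 := hT e he
      have h2 : ord e ≠ n := fun h => hn ⟨e, he, h⟩
      omega
    obtain ⟨e, heT, rfl⟩ := hn
    have herase : ∀ e', Sum.inl e' ∈ T.erase (Sum.inl e) → ord e' < ord e := by
      intro e' he'
      rw [Finset.mem_erase] at he'
      have h1 := hT e' he'.2
      have h2 : ord e' ≠ ord e := hinj.ne fun h => he'.1 (by rw [h])
      omega
    have hle : Submodule.span F (codingVector g '' (T.erase (Sum.inl e) : Set (ι ⊕ κ))) ≤
        Submodule.span F (codingVector g '' (T : Set (ι ⊕ κ))) :=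
      Submodule.span_mono (Set.image_mono (by exact_mod_cast Finset.erase_subset _ _))
    -- If the last symbol `e` is redundant, genericity lets its inputs replace it without enlarging
    -- the span. Otherwise dropping `e` lowers the dimension, which pays for adding `e` to the
    -- separator.
    by_cases hmem : g e ∈ Submodule.span F
        (codingVector g '' (T.erase (Sum.inl e) : Set (ι ⊕ κ)))
    · obtain ⟨C, hC, hcard⟩ := ih (T.erase (Sum.inl e) ∪ input e) fun e' he' =>
        (Finset.mem_union.1 he').elim (herase e') (hord e e')
      refine ⟨C, fun p hp => ?_, hcard.trans (Submodule.finrank_mono ?_)⟩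
      · by_cases hpe : p = Sum.inl e
        · subst hpe
          exact .of_input fun p hp => hC p (Finset.mem_union_right _ hp)
        · exact hC p (Finset.mem_union_left _ (Finset.mem_erase.2 ⟨hpe, hp⟩))
      · rw [Finset.coe_union, Set.image_union, Submodule.span_union]
        exact sup_le hle (((hg e).2 _ herase hmem).trans hle)
    · obtain ⟨C, hC, hcard⟩ := ih _ herase
      refine ⟨insert (Sum.inl e) C, fun p hp => ?_, ?_⟩
      · by_cases hpe : p = Sum.inl e
        · subst hpe
          exact .of_mem (Finset.mem_insert_self _ _)
        · exact (hC p (Finset.mem_erase.2 ⟨hpe, hp⟩)).mono (Finset.subset_insert _ _)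
      · have hlt := Submodule.finrank_lt_finrank_of_lt (lt_of_le_of_ne hle fun h => hmem (by
          rw [h]
          exact Submodule.subset_span ⟨Sum.inl e, heT, rfl⟩))
        have := Finset.card_insert_le (Sum.inl e) C
        omega

/-! ### Networks, cuts and multicast codes -/

namespace TwoUnicastNetwork

variable {V E : Type*}

/-- Acyclicity makes reachability of edges a partial order; in a linear extension, the number of
predecessors ranks the edges. -/
theorem exists_edge_order [Finite E] (N : TwoUnicastNetwork V E) :
    ∃ ord : E → ℕ, Function.Injective ord ∧
      ∀ e e', N.head e' = N.tail e → ord e' < ord e := by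
  classical
  have := Fintype.ofFinite E
  let r : E → E → Prop := Relation.ReflTransGen fun e' e => N.head e' = N.tail e
  have hlift : ∀ e' e, Relation.TransGen (fun e' e => N.head e' = N.tail e) e' e →
      Relation.TransGen (fun u w => ∃ e : E, N.tail e = u ∧ N.head e = w) (N.tail e') (N.tail e) :=
    by
    intro e' e h
    refine Relation.TransGen.lift N.tail ?_ _ _ h
    exact fun a b hab => ⟨a, rfl, hab⟩
  have : IsPartialOrder E r :=
    { refl := fun _ => Relation.ReflTransGen.refl
      trans := fun _ _ _ => Relation.ReflTransGen.trans
      antisymm := fun a b hab hba => by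
        rcases Relation.reflTransGen_iff_eq_or_transGen.1 hab with h | h
        · exact h.symm
        · exact absurd (hlift a a (h.trans_left hba)) (N.acyclic _) }
  obtain ⟨s, hs, hrs⟩ := extend_partialOrder r
  have hmono : ∀ a b, s a b → a ≠ b → (Finset.univ.filter fun d => s d a).card <
      (Finset.univ.filter fun d => s d b).card := by
    intro a b hab hne
    refine Finset.card_lt_card ((Finset.ssubset_iff_of_subset fun d hd => ?_).2 ⟨b, ?_, ?_⟩)
    · simp only [Finset.mem_filter, Finset.mem_univ, true_and] at hd ⊢
      exact _root_.trans hd hab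
    · simpa using refl_of s b
    · simpa using fun hba => hne (antisymm_of s hab hba)
  refine ⟨fun e => (Finset.univ.filter fun d => s d e).card, fun a b hab => ?_, fun e e' h => ?_⟩
  · by_contra hne
    rcases total_of s a b with h | h
    · exact (hmono a b h hne).ne hab
    · exact (hmono b a h (Ne.symm hne)).ne hab.symm
  · refine hmono e' e (hrs _ _ (Relation.ReflTransGen.single h)) ?_
    rintro rfl
    exact N.acyclic _ (Relation.TransGen.single ⟨e', rfl, h⟩)

open scoped Classical in
/-- The symbols available at the vertex `v`: those on its incoming edges, and the source symbols
if `v` is a source. -/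
noncomputable def symbolsAt [Fintype E] (N : TwoUnicastNetwork V E) (R : Fin 2 → ℕ) (v : V) :
    Finset (E ⊕ Σ i, Fin (R i)) :=
  (Finset.univ.filter fun e : E => N.head e = v).disjSum
    ((Finset.univ.filter fun i : Fin 2 => N.source i = v).sigma fun _ => Finset.univ)

@[simp]
theorem inl_mem_symbolsAt [Fintype E] (N : TwoUnicastNetwork V E) (R : Fin 2 → ℕ) (v : V) (e : E) :
    Sum.inl e ∈ N.symbolsAt R v ↔ N.head e = v := by
  simp [symbolsAt]

@[simp]
theorem inr_mem_symbolsAt [Fintype E] (N : TwoUnicastNetwork V E) (R : Fin 2 → ℕ) (v : V)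
    (q : Σ i, Fin (R i)) : Sum.inr q ∈ N.symbolsAt R v ↔ N.source q.1 = v := by
  simp [symbolsAt]

open scoped Classical in
theorem sum_symbolsAt [Fintype E] {F : Type*} [AddCommMonoid F] (N : TwoUnicastNetwork V E)
    (R : Fin 2 → ℕ) (v : V) (φ : E ⊕ (Σ i, Fin (R i)) → F) :
    ∑ p ∈ N.symbolsAt R v, φ p = ∑ e ∈ Finset.univ.filter (fun e : E => N.head e = v), φ (Sum.inl e)
      + ∑ i ∈ Finset.univ.filter (fun i : Fin 2 => N.source i = v),
          ∑ j : Fin (R i), φ (Sum.inr ⟨i, j⟩) := by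
  rw [symbolsAt, Finset.sum_disjSum, Finset.sum_sigma]

theorem mincut_le_ncard (N : TwoUnicastNetwork V E) {A B : Set (Fin 2)} (U : Set V)
    (hA : ∀ i ∈ A, N.source i ∈ U) (hB : ∀ j ∈ B, N.terminal j ∉ U) :
    N.mincut A B ≤ Set.ncard {e : E | N.tail e ∈ U ∧ N.head e ∉ U} :=
  Nat.sInf_le ⟨U, hA, hB, rfl⟩

theorem mincut_le_card [Fintype E] (N : TwoUnicastNetwork V E) (A B : Set (Fin 2)) :
    N.mincut A B ≤ Fintype.card E := by
  refine (N.mincut_le_ncard {v | ∃ i, N.source i = v} (fun i _ => ⟨i, rfl⟩) ?_).trans ?_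
  · rintro j - ⟨i, hi⟩
    exact N.source_ne_terminal i j hi
  · rw [← Nat.card_eq_fintype_card]
    exact Set.ncard_le_card _

/-- A set of symbols separating a terminal from the sources is at least as large as the total rate,
if every sum of rates is at most the corresponding minimum cut. -/
theorem sum_rates_le_card_of_blocked [Fintype E] (N : TwoUnicastNetwork V E) (R : Fin 2 → ℕ)
    (t : Fin 2) (hR : ∀ A : Finset (Fin 2), A.Nonempty → ∑ i ∈ A, R i ≤ N.mincut A {t})
    (C : Finset (E ⊕ Σ i, Fin (R i)))
    (hC : ∀ p ∈ N.symbolsAt R (N.terminal t), Blocked (fun e => N.symbolsAt R (N.tail e)) C p) :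
    ∑ i, R i ≤ C.card := by
  classical
  set input := fun e => N.symbolsAt R (N.tail e)
  let A : Finset (Fin 2) := Finset.univ.filter fun i => ∃ j : Fin (R i), Sum.inr ⟨i, j⟩ ∉ C
  -- An edge leaving `U` has a blocked symbol, but some input of it is not blocked, so the edge
  -- itself lies in `C`. Sources in `A` lie in `U` because a source symbol is blocked only by
  -- membership in `C`.
  let U : Set V := {v | ¬ ∀ p ∈ N.symbolsAt R v, Blocked input C p}
  have hA : ∑ i ∈ A, R i ≤ C.toLeft.card := by
    rcases A.eq_empty_or_nonempty with h | h
    · simp [h]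
    refine (hR A h).trans ((N.mincut_le_ncard U (fun i hi => ?_) ?_).trans ?_)
    · obtain ⟨j, hj⟩ := (Finset.mem_filter.1 hi).2
      intro hall
      have hb := hall (Sum.inr ⟨i, j⟩) (by simp)
      cases hb with
      | of_mem hp => exact hj hp
    · rintro j rfl hj
      exact hj hC
    · rw [← Set.ncard_coe_finset]
      refine Set.ncard_le_ncard ?_ (Finset.finite_toSet _)
      rintro e ⟨htail, hhead⟩
      have hb := not_not.1 hhead (Sum.inl e) (by simp)
      cases hb with
      | of_mem hp => simpa using hp
      | of_input he => exact absurd he htail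
  have hAc : ∑ i ∈ Aᶜ, R i ≤ C.toRight.card := by
    have hsub : Aᶜ.sigma (fun i => (Finset.univ : Finset (Fin (R i)))) ⊆ C.toRight := by
      rintro ⟨i, j⟩ hij
      simp only [Finset.mem_sigma, Finset.mem_compl, A, Finset.mem_filter, Finset.mem_univ,
        true_and, not_exists, not_not, and_true] at hij
      simpa using hij j
    simpa using Finset.card_le_card hsub
  rw [← Finset.sum_add_sum_compl A, ← Finset.card_toLeft_add_card_toRight]
  exact add_le_add hA hAc

/-- Rates all of whose sums are at most the corresponding minimum cuts to both terminals are
attained by a linear multicast code over any large enough field. -/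
theorem exists_isMulticast [Fintype E] (N : TwoUnicastNetwork V E) (R : Fin 2 → ℕ)
    (hR : ∀ t, ∀ A : Finset (Fin 2), A.Nonempty → ∑ i ∈ A, R i ≤ N.mincut A {t})
    (F : Type*) [Field F] [Finite F]
    (hF : 2 ^ (Fintype.card E + ∑ i, R i) < Nat.card F) :
    ∃ c : N.LinearCode F R, c.IsMulticast := by
  classical
  obtain ⟨ord, hinj, hord⟩ := N.exists_edge_order
  have hord' : ∀ e e', Sum.inl e' ∈ N.symbolsAt R (N.tail e) → ord e' < ord e :=
    fun e e' h => hord e e' (by simpa using h)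
  obtain ⟨g, hg⟩ := exists_isGenericAt F (fun e => N.symbolsAt R (N.tail e)) ord hinj hord'
    (by simpa using hF)
  have hcoef := fun e => (Submodule.mem_span_image_finset_iff_exists_fun' F).1 (hg e).1
  choose c hc using hcoef
  let code : N.LinearCode F R :=
    { a := fun i j e => c e (Sum.inr ⟨i, j⟩)
      f := fun e' e => c e (Sum.inl e')
      signal := fun x e => g e ⬝ᵥ fun q => x q.1 q.2
      signal_eq := fun x e => by
        conv_lhs => rw [← hc e]
        rw [sum_dotProduct, sum_symbolsAt]
        simp [codingVector, smul_dotProduct] }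
  refine ⟨code, fun t i => ?_⟩
  obtain ⟨C, hC, hcard⟩ := exists_blocking_card_le_finrank
    (fun e => N.symbolsAt R (N.tail e)) ord hinj hord' g hg (Finset.univ.sup ord + 1)
    (N.symbolsAt R (N.terminal t))
    fun e _ => Nat.lt_succ_of_le (Finset.le_sup (Finset.mem_univ e))
  have htop : Submodule.span F
      (codingVector g '' (N.symbolsAt R (N.terminal t) : Set (E ⊕ Σ i, Fin (R i)))) = ⊤ := by
    refine Submodule.eq_top_of_finrank_eq (le_antisymm (Submodule.finrank_le _) ?_)
    have := N.sum_rates_le_card_of_blocked R t (hR t) C hC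
    simpa using this.trans hcard
  have hinjective : ∀ x y : (i : Fin 2) → Fin (R i) → F,
      (∀ e, N.head e = N.terminal t → code.signal x e = code.signal y e) → x = y := by
    intro x y hxy
    have hdot : ∀ w : (Σ i, Fin (R i)) → F,
        (w ⬝ᵥ fun q => x q.1 q.2) = w ⬝ᵥ fun q => y q.1 q.2 := by
      intro w
      have hw : w ∈ Submodule.span F
          (codingVector g '' (N.symbolsAt R (N.terminal t) : Set (E ⊕ Σ i, Fin (R i)))) :=
        htop ▸ Submodule.mem_top
      induction hw using Submodule.span_induction with
      | mem w hw =>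
        obtain ⟨e | q, hp, rfl⟩ := hw
        · exact hxy e (by simpa using hp)
        · exact absurd (by simpa using hp) (N.source_ne_terminal q.1 t)
      | zero => simp
      | add u v _ _ hu hv => rw [add_dotProduct, add_dotProduct, hu, hv]
      | smul a u _ hu => rw [smul_dotProduct, smul_dotProduct, hu]
    funext i j
    simpa using hdot (Pi.single ⟨i, j⟩ 1)
  -- Injectivity makes the chosen preimage the true one; the value `0` off the image is irrelevant.
  refine ⟨fun s => if h : ∃ x, (fun e : {e : E // N.head e = N.terminal t} =>
    code.signal x e.1) = s then h.choose i else 0, fun x => ?_⟩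
  have h : ∃ y, (fun e : {e : E // N.head e = N.terminal t} => code.signal y e.1) =
    fun e => code.signal x e.1 := ⟨x, rfl⟩
  refine (dif_pos h).trans ?_
  rw [hinjective h.choose x fun e he => congrFun h.choose_spec ⟨e, he⟩]

end TwoUnicastNetwork

/-! ### Integer points of the rate polygon -/

/-- The polygon `0 ≤ x ≤ a`, `0 ≤ y ≤ b`, `x + y ≤ c` with integral `a`, `b`, `c` is contained in
the convex hull of its integer points. -/
theorem mem_convexHull_natCast_of_le (a b c : ℕ) (x y : ℝ) (hx : 0 ≤ x) (hy : 0 ≤ y) (hxa : x ≤ a)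
    (hyb : y ≤ b) (hxy : x + y ≤ c) :
    (x, y) ∈ convexHull ℝ {p : ℝ × ℝ | ∃ m n : ℕ, m ≤ a ∧ n ≤ b ∧ m + n ≤ c ∧ p = (↑m, ↑n)} := by
  set S := {p : ℝ × ℝ | ∃ m n : ℕ, m ≤ a ∧ n ≤ b ∧ m + n ≤ c ∧ p = (↑m, ↑n)}
  have combine : ∀ p ∈ S, ∀ q ∈ S, ∀ r ∈ S, ∀ u v w : ℝ, 0 ≤ u → 0 ≤ v → 0 ≤ w → u + v + w = 1 →
      (x, y) = u • p + v • q + w • r → (x, y) ∈ convexHull ℝ S := by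
    intro p hp q hq r hr u v w hu hv hw hsum heq
    rw [heq]
    have := (convex_convexHull ℝ S).sum_mem (t := Finset.univ) (w := ![u, v, w]) (z := ![p, q, r])
      (by intro i _; fin_cases i <;> assumption)
      (by simpa [Fin.sum_univ_three] using hsum)
      (by intro i _; fin_cases i <;> exact subset_convexHull ℝ S (by assumption))
    simpa [Fin.sum_univ_three] using this
  have hm := Nat.floor_le hx
  have hm' := Nat.lt_floor_add_one x
  have hn := Nat.floor_le hy
  have hn' := Nat.lt_floor_add_one y
  set m := ⌊x⌋₊
  set n := ⌊y⌋₊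
  have hma : m ≤ a := by exact_mod_cast hm.trans hxa
  have hnb : n ≤ b := by exact_mod_cast hn.trans hyb
  have hmn : m + n ≤ c := by
    have : (m + n : ℝ) ≤ c := by linarith
    exact_mod_cast this
  have hsucc : ∀ k l : ℕ, ∀ z : ℝ, (k : ℝ) < z → z ≤ l → k + 1 ≤ l := by
    intro k l z h1 h2
    have : (k : ℝ) < l := h1.trans_le h2
    exact_mod_cast this
  have hmn0 : ((m : ℝ), (n : ℝ)) ∈ S := ⟨m, n, hma, hnb, hmn, rfl⟩
  have hright : m < x → ((m : ℝ) + 1, (n : ℝ)) ∈ S := fun h =>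
    ⟨m + 1, n, hsucc m a x h hxa, hnb, by
      have := hsucc (m + n) c (x + y) (by push_cast; linarith) hxy
      omega, by push_cast; rfl⟩
  have hup : n < y → ((m : ℝ), (n : ℝ) + 1) ∈ S := fun h =>
    ⟨m, n + 1, hma, hsucc n b y h hyb, by
      have := hsucc (m + n) c (x + y) (by push_cast; linarith) hxy
      omega, by push_cast; rfl⟩
  rcases hm.eq_or_lt with hxm | hxm <;> rcases hn.eq_or_lt with hyn | hyn
  · refine combine _ hmn0 _ hmn0 _ hmn0 1 0 0 ?_ ?_ ?_ ?_ ?_ <;> simp [hxm, hyn]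
  · refine combine _ hmn0 _ (hup hyn) _ hmn0 (1 - (y - n)) (y - n) 0 ?_ ?_ le_rfl ?_ ?_
    · linarith
    · linarith
    · ring
    · ext <;> simp <;> linarith
  · refine combine _ hmn0 _ (hright hxm) _ hmn0 (1 - (x - m)) (x - m) 0 ?_ ?_ le_rfl ?_ ?_
    · linarith
    · linarith
    · ring
    · ext <;> simp <;> linarith
  -- The antidiagonal cuts the unit cell into two triangles. In the upper one `x + y > m + n + 1`,
  -- so integrality of `c` admits the far corner.
  · by_cases hfrac : (x - m) + (y - n) ≤ 1
    · refine combine _ hmn0 _ (hright hxm) _ (hup hyn) (1 - (x - m) - (y - n)) (x - m) (y - n)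
        ?_ ?_ ?_ ?_ ?_
      · linarith
      · linarith
      · linarith
      · ring
      · ext <;> simp <;> ring
    · have hdiag : ((m : ℝ) + 1, (n : ℝ) + 1) ∈ S :=
        ⟨m + 1, n + 1, hsucc m a x hxm hxa, hsucc n b y hyn hyb, by
          have := hsucc (m + n + 1) c (x + y) (by push_cast; linarith) hxy
          omega, by push_cast; rfl⟩
      refine combine _ (hright hxm) _ (hup hyn) _ hdiag (1 - (y - n)) (1 - (x - m))
        ((x - m) + (y - n) - 1) ?_ ?_ ?_ ?_ ?_
      · linarith
      · linarith
      · linarith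
      · ring
      · ext <;> simp <;> ring

/-! ### The base region -/

theorem TwoUnicastNetwork.sum_le_mincut_of_mem_baseRegion {V E : Type*} (N : TwoUnicastNetwork V E)
    (R : Fin 2 → ℕ) (hR : ((R 0 : ℝ), (R 1 : ℝ)) ∈ N.baseRegion) (t : Fin 2)
    (A : Finset (Fin 2)) (hA : A.Nonempty) : ∑ i ∈ A, R i ≤ N.mincut A {t} := by
  obtain ⟨-, -, h1, h2, h3⟩ := hR
  simp only [le_min_iff] at h1 h2 h3
  norm_cast at h1 h2 h3
  have hcases : A = {0} ∨ A = {1} ∨ A = {0, 1} := by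
    revert hA; revert A; decide
  rcases hcases with rfl | rfl | rfl <;> fin_cases t <;> simp <;> tauto

theorem mainTheorem3 {V E : Type*} [Finite V] [Fintype E] (N : TwoUnicastNetwork V E) :
    ∃ (F : Type) (_ : Field F) (_ : Finite F),
      (∀ R : Fin 2 → ℕ, ((R 0 : ℝ), (R 1 : ℝ)) ∈ N.baseRegion →
        ∃ c : N.LinearCode F R, c.IsUnicast ∧ c.IsMulticast) ∧
      N.baseRegion ⊆ N.timeSharedRates F := by
  -- One copy of the edge count in the exponent counts edge symbols, the other bounds the source
  -- symbols.
  obtain ⟨p, hp, hprime⟩ :=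
    Nat.exists_infinite_primes (2 ^ (Fintype.card E + Fintype.card E) + 1)
  have : Fact p.Prime := ⟨hprime⟩
  have hcodes : ∀ R : Fin 2 → ℕ, ((R 0 : ℝ), (R 1 : ℝ)) ∈ N.baseRegion →
      ∃ c : N.LinearCode (ZMod p) R, c.IsUnicast ∧ c.IsMulticast := by
    intro R hR
    have hcut := N.sum_le_mincut_of_mem_baseRegion R hR
    have hsum : ∑ i, R i ≤ Fintype.card E :=
      (hcut 0 Finset.univ Finset.univ_nonempty).trans (N.mincut_le_card _ _)
    obtain ⟨c, hc⟩ := N.exists_isMulticast R hcut (ZMod p) (by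
      rw [Nat.card_zmod]
      exact (Nat.pow_le_pow_right two_pos (Nat.add_le_add_left hsum _)).trans_lt hp)
    exact ⟨c, fun i => hc i i, hc⟩
  refine ⟨ZMod p, inferInstance, inferInstance, hcodes, ?_⟩
  rintro ⟨x, y⟩ ⟨hx, hy, h1, h2, h3⟩
  refine convexHull_mono ?_ (mem_convexHull_natCast_of_le (min (N.mincut {0} {1}) (N.mincut {0} {0}))
    (min (N.mincut {1} {0}) (N.mincut {1} {1})) (min (N.mincut {0, 1} {0}) (N.mincut {0, 1} {1}))
    x y hx hy (by exact_mod_cast h1) (by exact_mod_cast h2) (by exact_mod_cast h3))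
  rintro _ ⟨m, n, hm, hn, hmn, rfl⟩
  refine ⟨![m, n], hcodes ![m, n] ⟨by simp, by simp, ?_, ?_, ?_⟩, by simp⟩
  · simp only [Matrix.cons_val_zero]
    exact_mod_cast hm
  · simp only [Matrix.cons_val_zero, Matrix.cons_val_one]
    exact_mod_cast hn
  · simp only [Matrix.cons_val_zero, Matrix.cons_val_one]
    exact_mod_cast hmn
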